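/- Let $\Gamma$ be a finite graph (parallel edges allowed, loops forbidden) with a fixed preferred orientation of each edge, and let $q:V(\Gamma)\to\mathbb R^d$ be injective, with image the configuration $\mathcal Q$. For an edge $e$ oriented from $u$ to $v$ put $q_e=q_v-q_u$. A gain function, given by its values on the preferred orientations, is a point $g$ of the edge space $\mathbb R^{E(\Gamma)}$; its Pythagorean arrangement consists of the hyperplanes, labeled by the edges, $$h_e=\{x\in\mathbb R^d : |x-q_u|^2-|x-q_v|^2=g(e)\}.$$ A set $S$ of edges is central for $g$ if $\bigcap_{e\in S}h_e\neq\emptyset$. Let $M=M_\Gamma(\mathcal Q)$ be the matroid at infinity: the matroid on $E(\Gamma)$ in which $S$ is independent if and only if $(q_e)_{e\in S}$ is linearly independent. Let $r$ be its rank and fix orthonormal coordinates on the $r$-dimensional span of the vectors $q_e$ (for $r=d$, the coordinates of $\mathbb R^d$). For a circuit $X$ of $M$ choose $x\in X$ and a basis $B$ of $M$ such that $X$ is the fundamental circuit of $x$ with respect to $B$. The hyperplane of nongenericity $F_X\subseteq\mathbb R^{E(\Gamma)}$ is the set of all $\gamma$ for which the $(r+1)\times(r+1)$ matrix with the rows $$\bigl(q_v-q_u,\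 -\tfrac12(\gamma_e+|q_v|^2-|q_u|^2)\bigr),\qquad e\in B\cup\{x\}\text{ oriented from } u\text{ to } v,$$ has determinant $0$; this does not depend on the choices. Let $\mathcal F(\mathcal Q,\Gamma)$ be the arrangement of all $F_X$, with $X$ a circuit of $M$. Its flats are the nonempty intersections of its members (including the empty intersection $\mathbb R^{E(\Gamma)}$), ordered by reverse inclusion. For a set $A$ in edge space let $\mathcal C(A)=\{X \text{ a circuit of } M : F_X\supseteq A\}$, and for $g\in\mathbb R^{E(\Gamma)}$ let $A_g$ be the intersection of all $F_X$ that contain $g$. 1. For each flat $A$ of $\mathcal F(\mathcal Q,\Gamma)$, the set $\mathcal C(A)$ is a linear class of circuits of $M$: whenever $T\subseteq\mathcal C(A)$ is a modular family (there is a basis $B$ of $M$ such that $Y\cap B$ is a basis of $Y$ for all $Y\in T$; for two circuits $Y,Z$ this says $\operatorname{rk}(Y\cap Z)+\operatorname{rk}(Y\cup Z)=\operatorname{rk}Y+\operatorname{rk}Z$), every circuit of $M$ contained in $\bigcup T$ belongs to $\mathcal C(A)$. 2. For each gain function $g$, the set of circuits of $M$ that are central for $g$ is $\mathcal C(A_g)$.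 3. The flats of $\mathcal F(\mathcal Q,\Gamma)$ form a lattice. It is isomorphic, as an ordered set, to the set of semimatroids on $E(\Gamma)$ realizable as the Pythagorean arrangement of some gain function $g$, by an isomorphism that takes each flat of the form $A_g$ to the semimatroid of $g$. Here the semimatroid of $g$ has as central sets the sets central for $g$, the rank of $S$ being the codimension of $\bigcap_{e\in S}h_e$; and semimatroids are ordered by $\sigma\le\tau$ if every set central in $\sigma$ is central in $\tau$, with the same rank. -/

import Mathlib

open Set
open scoped Graph Matrix

noncomputable section

namespace Pythagorean

/-! ### Matroids -/

/-- The vectorial matroid of a finite family of real vectors: its ground set is the index type, and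
a set of indices is independent when the corresponding subfamily is linearly independent. -/
def vectorMatroid {ι W : Type*} [Finite ι] [AddCommGroup W] [Module ℝ W] (v : ι → W) :
    Matroid ι :=
  (IndepMatroid.ofFinite (E := Set.univ) Set.finite_univ (fun I => LinearIndepOn ℝ v I)
    (linearIndepOn_empty ℝ v)
    (fun _ _ hJ hIJ => hJ.mono hIJ)
    (by
      intro I J hI hJ hlt
      by_contra hcon
      push Not at hcon
      have hsub : v '' J ⊆ (Submodule.span ℝ (v '' I) : Set W) := by
        rintro _ ⟨e, he, rfl⟩
        by_cases heI : e ∈ I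
        · exact Submodule.subset_span ⟨e, heI, rfl⟩
        · by_contra hns
          exact hcon e he heI (hI.insert hns)
      have hle : Submodule.span ℝ (v '' J) ≤ Submodule.span ℝ (v '' I) :=
        Submodule.span_le.2 hsub
      have hcard : ∀ K : Set ι, LinearIndepOn ℝ v K →
          Module.finrank ℝ (Submodule.span ℝ (v '' K)) = K.ncard := by
        intro K hK
        have : Fintype K := Fintype.ofFinite K
        have h := finrank_span_eq_card (R := ℝ) (b := fun x : K => v x) hK
        rw [← Set.image_eq_range] at h
        rw [h, ← Nat.card_coe_set_eq, Nat.card_eq_fintype_card]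
      have : FiniteDimensional ℝ (Submodule.span ℝ (v '' I)) :=
        FiniteDimensional.span_of_finite ℝ (Set.toFinite _)
      have := Submodule.finrank_mono hle
      rw [hcard I hI, hcard J hJ] at this
      omega)
    (fun _ _ => Set.subset_univ _)).matroid

/-- `S, T` is a modular pair of `M` when `rk (S ∩ T) + rk (S ∪ T) = rk S + rk T`. -/
def IsModularPair {ι : Type*} (M : Matroid ι) (S T : Set ι) : Prop :=
  M.eRk (S ∩ T) + M.eRk (S ∪ T) = M.eRk S + M.eRk T

/-- A modular family of sets of `M`: some basis of `M` meets every member of the family in a basis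
of that member.  For a family of two sets this is `IsModularPair`; a family of circuits is modular
exactly when all its members are fundamental circuits of one common basis. -/
def IsModularFamily {ι : Type*} (M : Matroid ι) (T : Set (Set ι)) : Prop :=
  ∃ B, M.IsBase B ∧ ∀ X ∈ T, M.IsBasis (X ∩ B) X

/-- A linear class of circuits of `M`: a set `S` of circuits that contains every circuit included in
the union of a modular family of members of `S`. -/
def IsLinearClass {ι : Type*} (M : Matroid ι) (S : Set (Set ι)) : Prop :=
  (∀ X ∈ S, M.IsCircuit X) ∧
    ∀ T ⊆ S, IsModularFamily M T → ∀ X, M.IsCircuit X → X ⊆ ⋃₀ T → X ∈ S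

lemma sum_smul_eq_zero_iff_inner {ι κ m W : Type*} [Fintype m] [NormedAddCommGroup W]
    [InnerProductSpace ℝ W] {u : κ → W} {v : ι → W}
    (hu : Submodule.span ℝ (range u) = Submodule.span ℝ (range v)) {s : m → ι} {w : m → ℝ} :
    ∑ i, w i • v (s i) = 0 ↔ ∀ j, inner ℝ (u j) (∑ i, w i • v (s i)) = 0 := by
  constructor
  · intro h j
    rw [h, inner_zero_right]
  · intro h
    generalize hz : ∑ i, w i • v (s i) = z at h
    have hzs : z ∈ Submodule.span ℝ (range u) := by
      rw [hu, ← hz]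
      exact Submodule.sum_mem _ fun i _ => Submodule.smul_mem _ _ (Submodule.subset_span ⟨_, rfl⟩)
    have hle : Submodule.span ℝ (range u) ≤ (Submodule.span ℝ {z})ᗮ := by
      rw [Submodule.span_le]
      rintro _ ⟨j, rfl⟩
      exact (Submodule.mem_orthogonal_singleton_iff_inner_left).2 (h j)
    have := (Submodule.mem_orthogonal_singleton_iff_inner_left).1 (hle hzs)
    exact inner_self_eq_zero.1 this

lemma exists_relation_iff {ι W : Type*} [Finite ι] [AddCommGroup W] [Module ℝ W] {v : ι → W}
    {r : ℕ} {s : Fin (r + 1) → ι} (hs : Function.Injective s)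
    (hB : LinearIndepOn ℝ v (range fun i : Fin r => s i.castSucc)) {X : Set ι}
    (hXs : X ⊆ range s) (hX : ¬ LinearIndepOn ℝ v X) (k : ι → ℝ) :
    (∃ w : Fin (r + 1) → ℝ, w ≠ 0 ∧ ∑ i, w i • v (s i) = 0 ∧ ∑ i, w i * k (s i) = 0) ↔
      ∀ c : ι → ℝ, (∀ e ∉ X, c e = 0) → ∑ᶠ e, c e • v e = 0 → ∑ᶠ e, c e * k e = 0 := by
  classical
  have : Fintype ι := Fintype.ofFinite _
  have hli : LinearIndependent ℝ fun i : Fin r => v (s i.castSucc) :=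
    (linearIndepOn_range_iff (hs.comp (Fin.castSucc_injective _)) _).1 hB
  have hsum : ∀ {N : Type _} [AddCommGroup N] [Module ℝ N] (c : ι → ℝ) (f : ι → N),
      (∀ e ∉ X, c e = 0) → ∑ᶠ e, c e • f e = ∑ i, c (s i) • f (s i) := by
    intro N _ _ c f hc
    rw [finsum_eq_sum_of_fintype, ← Finset.sum_image (f := fun e => c e • f e) (s := Finset.univ)
      (g := s) (fun a _ b _ h => hs h)]
    refine (Finset.sum_subset (Finset.subset_univ _) fun e _ he => ?_).symm
    rw [hc e fun heX => he ?_, zero_smul]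
    obtain ⟨i, rfl⟩ := hXs heX
    exact Finset.mem_image_of_mem _ (Finset.mem_univ i)
  have hsum' : ∀ (c : ι → ℝ),
      (∀ e ∉ X, c e = 0) → ∑ᶠ e, c e * k e = ∑ i, c (s i) * k (s i) := by
    intro c hc
    rw [finsum_eq_sum_of_fintype, ← Finset.sum_image (f := fun e => c e * k e) (s := Finset.univ)
      (g := s) (fun a _ b _ h => hs h)]
    refine (Finset.sum_subset (Finset.subset_univ _) fun e _ he => ?_).symm
    rw [hc e fun heX => he ?_, zero_mul]
    obtain ⟨i, rfl⟩ := hXs heX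
    exact Finset.mem_image_of_mem _ (Finset.mem_univ i)
  have hzero : ∀ w : Fin (r + 1) → ℝ, ∑ i, w i • v (s i) = 0 → w (Fin.last _) = 0 → w = 0 := by
    intro w hw hl
    rw [Fin.sum_univ_castSucc, hl, zero_smul, add_zero] at hw
    have := Fintype.linearIndependent_iff.1 hli _ hw
    funext i
    exact Fin.lastCases hl (fun j => this j) i
  constructor
  · rintro ⟨w, hw0, hw, hwG⟩ c hc hcv
    have hwl : w (Fin.last _) ≠ 0 := fun h => hw0 (hzero w hw h)
    rw [hsum c _ hc] at hcv
    rw [hsum' c hc]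
    obtain ⟨t, ht⟩ : ∃ t, t = c (s (Fin.last _)) / w (Fin.last _) := ⟨_, rfl⟩
    have h0 : (fun i => c (s i) - t * w i) = 0 := by
      apply hzero
      · simp only [sub_smul, mul_smul, Finset.sum_sub_distrib, ← Finset.smul_sum, hw, hcv]
        simp
      · rw [ht]
        field_simp
        simp
    have h1 : ∀ i, c (s i) = t * w i := fun i => sub_eq_zero.1 (congrFun h0 i)
    simp only [h1, mul_assoc, ← Finset.mul_sum, hwG, mul_zero]
  · intro h
    rw [LinearIndepOn, Fintype.not_linearIndependent_iff] at hX
    obtain ⟨c₀, hc₀, ⟨x, hx⟩, hne⟩ := hX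
    obtain ⟨c, hcdef⟩ : ∃ c : ι → ℝ, c = fun e => if he : e ∈ X then c₀ ⟨e, he⟩ else 0 := ⟨_, rfl⟩
    have hc : ∀ e ∉ X, c e = 0 := fun e he => by simp [hcdef, he]
    have hcv : ∑ᶠ e, c e • v e = 0 := by
      rw [finsum_eq_sum_of_fintype, ← hc₀]
      rw [← Finset.sum_subset (Finset.subset_univ X.toFinset)
        (fun e _ he => by rw [hc e (by simpa using he), zero_smul])]
      rw [← Finset.sum_coe_sort X.toFinset]
      refine Fintype.sum_equiv (Equiv.subtypeEquivRight (by simp)) _ _ ?_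
      rintro ⟨e, he⟩
      have he' : e ∈ X := by simpa using he
      simp only [hcdef, dif_pos he']
      rfl
    refine ⟨fun i => c (s i), ?_, ?_, ?_⟩
    · intro h0
      obtain ⟨i, hi⟩ := hXs hx
      apply hne
      have := congrFun h0 i
      simpa [hcdef, hi, hx] using this
    · rw [← hsum c v hc, hcv]
    · rw [← hsum' c hc, h c hc hcv]

lemma exists_enum_of_isBase {ι W : Type*} [Finite ι] [AddCommGroup W] [Module ℝ W] {v : ι → W}
    {B : Set ι} (hB : (vectorMatroid v).IsBase B) :
    ∃ (r : ℕ) (b : Fin r → ι), Function.Injective b ∧ range b = B ∧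
      Module.finrank ℝ (Submodule.span ℝ (range v)) = r := by
  have : Fintype B := Fintype.ofFinite _
  have hi : LinearIndepOn ℝ v B := hB.indep
  have hsp : Submodule.span ℝ (range v) = Submodule.span ℝ (v '' B) := by
    refine le_antisymm (Submodule.span_le.2 ?_) (Submodule.span_mono (image_subset_range _ _))
    rintro _ ⟨e, rfl⟩
    by_cases he : e ∈ B
    · exact Submodule.subset_span ⟨e, he, rfl⟩
    · by_contra hns
      have h1 : (vectorMatroid v).Indep (insert e B) := hi.insert hns
      exact he (hB.eq_of_subset_indep h1 (subset_insert _ _) ▸ mem_insert e B)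
  refine ⟨Fintype.card B, fun i => ((Fintype.equivFin B).symm i : ι), ?_, ?_, ?_⟩
  · exact Subtype.val_injective.comp (Equiv.injective _)
  · ext e
    simp only [mem_range]
    constructor
    · rintro ⟨i, rfl⟩
      exact Subtype.coe_prop _
    · intro he
      exact ⟨Fintype.equivFin B ⟨e, he⟩, by simp⟩
  · rw [hsp, image_eq_range]
    exact finrank_span_eq_card hi

lemma exists_orthonormal_of_finrank {ι W : Type*} [NormedAddCommGroup W] [InnerProductSpace ℝ W]
    [FiniteDimensional ℝ W] {v : ι → W} {r : ℕ}
    (hr : Module.finrank ℝ (Submodule.span ℝ (range v)) = r) :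
    ∃ u : Fin r → W, Orthonormal ℝ u ∧
      Submodule.span ℝ (range u) = Submodule.span ℝ (range v) := by
  subst hr
  obtain ⟨b⟩ : Nonempty (OrthonormalBasis (Fin (Module.finrank ℝ (Submodule.span ℝ (range v)))) ℝ
    (Submodule.span ℝ (range v))) := ⟨stdOrthonormalBasis ℝ _⟩
  refine ⟨fun i => (b i : W), ?_, ?_⟩
  · exact b.orthonormal.comp_linearIsometry (Submodule.span ℝ (range v)).subtypeₗᵢ
  · have h := congrArg (Submodule.map (Submodule.span ℝ (range v)).subtype) b.toBasis.span_eq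
    rw [Submodule.map_span, ← range_comp, Submodule.map_subtype_top] at h
    simpa [Function.comp_def] using h

/-- For two sets, modular families are modular pairs. -/
lemma isModularFamily_pair_iff {ι : Type*} {M : Matroid ι} [M.RankFinite] {S T : Set ι}
    (hS : S ⊆ M.E) (hT : T ⊆ M.E) : IsModularFamily M {S, T} ↔ IsModularPair M S T := by
  constructor
  · rintro ⟨B, hB, h⟩
    have h1 := h S (by simp)
    have h2 := h T (by simp)
    have h3 : M.IsBasis ((S ∩ B) ∪ (T ∩ B)) (S ∪ T) :=
      h1.union_isBasis_union h2 (hB.indep.subset (by grind))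
    refine le_antisymm (M.eRk_inter_add_eRk_union_le S T) ?_
    have h4 : (S ∩ B ∩ (T ∩ B)).encard ≤ M.eRk (S ∩ T) :=
      (hB.indep.subset (by grind)).encard_le_eRk_of_subset (by grind)
    rw [h1.eRk_eq_encard, h2.eRk_eq_encard, h3.eRk_eq_encard, ← encard_union_add_encard_inter,
      add_comm]
    gcongr
  · intro h
    obtain ⟨I, hI⟩ := M.exists_isBasis (S ∩ T) (inter_subset_left.trans hS)
    obtain ⟨J, hJ, hIJ⟩ := hI.indep.subset_isBasis_of_subset
      (hI.subset.trans inter_subset_left) hS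
    obtain ⟨K, hK, hJK⟩ := hJ.indep.subset_isBasis_of_subset
      (hJ.subset.trans (subset_union_left (t := T))) (union_subset hS hT)
    obtain ⟨B, hB, hKB⟩ := hK.indep.exists_isBase_superset
    have eK : K = (S ∪ T) ∩ B := hK.eq_of_subset_indep (hB.indep.subset inter_subset_right)
      (subset_inter hK.subset hKB) inter_subset_left
    have eJ : J = S ∩ B := hJ.eq_of_subset_indep (hB.indep.subset inter_subset_right)
      (subset_inter hJ.subset (hJK.trans hKB)) inter_subset_left
    have eI : I = S ∩ T ∩ B := hI.eq_of_subset_indep (hB.indep.subset inter_subset_right)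
      (subset_inter hI.subset (hIJ.trans (hJK.trans hKB))) inter_subset_left
    have hfin : B.Finite := hB.finite
    have hc := encard_union_add_encard_inter (S ∩ B) (T ∩ B)
    have hT' : (T ∩ B).encard = M.eRk T := by
      rw [IsModularPair, hI.eRk_eq_encard, hJ.eRk_eq_encard, hK.eRk_eq_encard, eK, eJ, eI] at h
      rw [← union_inter_distrib_right, show S ∩ B ∩ (T ∩ B) = S ∩ T ∩ B by grind, add_comm, h] at hc
      exact (WithTop.add_left_cancel (encard_ne_top_iff.2 (hfin.subset inter_subset_right)) hc).symm
    refine ⟨B, hB, ?_⟩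
    rintro X (rfl | rfl)
    · rwa [← eJ]
    · obtain ⟨L, hL, hTL⟩ := (hB.indep.subset (inter_subset_right (s := X))).subset_isBasis_of_subset
        inter_subset_left hT
      have : X ∩ B = L := (hfin.subset inter_subset_right).eq_of_subset_of_encard_le hTL
        (by rw [hT', hL.eRk_eq_encard])
      rwa [this]

/-! ### Semimatroids -/

/-- A semimatroid on the (finite) label set `ι`: a family of central sets with a rank function on
the central sets. -/
@[ext]
structure Semimatroid (ι : Type*) where
  central : Set (Set ι)
  rk : central → ℕ
  nonempty : central.Nonempty
  hereditary : ∀ ⦃X Y : Set ι⦄, X ∈ central → Y ⊆ X → Y ∈ central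
  subcardinal : ∀ X : central, (rk X : ℕ∞) ≤ (X : Set ι).encard
  isotone : ∀ X Y : central, (X : Set ι) ⊆ Y → rk X ≤ rk Y
  submodular : ∀ X Y I U : central, (I : Set ι) = (X : Set ι) ∩ Y → (U : Set ι) = (X : Set ι) ∪ Y →
    rk I + rk U ≤ rk X + rk Y
  union_central : ∀ X Y I : central, (I : Set ι) = (X : Set ι) ∩ Y → rk I = rk X →
    (X : Set ι) ∪ Y ∈ central
  augment : ∀ X Y : central, rk X < rk Y →
    ∃ y ∈ (Y : Set ι) \ (X : Set ι), insert y (X : Set ι) ∈ central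

/-- Labeled semimatroids are ordered by inclusion of their families of central sets, compatibly with
rank: `σ ≤ τ` when every central set of `σ` is central in `τ`, with the same rank. -/
instance {ι : Type*} : PartialOrder (Semimatroid ι) where
  le σ τ := ∀ X : σ.central, ∃ h : (X : Set ι) ∈ τ.central, τ.rk ⟨X, h⟩ = σ.rk X
  le_refl σ X := ⟨X.2, rfl⟩
  le_trans σ τ ρ h₁ h₂ X := by
    obtain ⟨hX, e⟩ := h₁ X
    obtain ⟨hX', e'⟩ := h₂ ⟨X, hX⟩
    exact ⟨hX', e'.trans e⟩
  le_antisymm σ τ h₁ h₂ := by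
    have hc : σ.central = τ.central :=
      Set.Subset.antisymm (fun X hX => (h₁ ⟨X, hX⟩).1) (fun X hX => (h₂ ⟨X, hX⟩).1)
    obtain ⟨c, r, _, _, _, _, _, _, _⟩ := σ
    obtain ⟨c', r', _, _, _, _, _, _, _⟩ := τ
    obtain rfl : c = c' := hc
    have hr : r = r' := by
      funext X
      obtain ⟨_, e⟩ := h₁ X
      exact e.symm
    subst hr
    rfl

/-! ### Flats of a finite arrangement -/

/-- `A` is a flat of the family `H` when it is a nonempty intersection of members of `H`; the empty
intersection, i.e. the whole space, is allowed. -/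
def IsFlat {ι P : Type*} (H : ι → Set P) (A : Set P) : Prop :=
  A.Nonempty ∧ ∃ T : Set ι, A = ⋂ i ∈ T, H i

/-- The flats of `H`. -/
@[ext]
structure Flat {ι P : Type*} (H : ι → Set P) where
  carrier : Set P
  isFlat : IsFlat H carrier

/-- Flats are ordered by reverse inclusion. -/
instance {ι P : Type*} (H : ι → Set P) : PartialOrder (Flat H) where
  le A B := B.carrier ⊆ A.carrier
  le_refl _ := Set.Subset.rfl
  le_trans _ _ _ h₁ h₂ := Set.Subset.trans h₂ h₁
  le_antisymm _ _ h₁ h₂ := Flat.ext (Set.Subset.antisymm h₂ h₁)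

/-! ### Pythagorean arrangements -/

/-- A choice of a preferred orientation, from `tail` to `head`, of every edge of `Γ`. -/
structure EdgeOrientation {α β : Type*} (Γ : Graph α β) where
  tail : E(Γ) → V(Γ)
  head : E(Γ) → V(Γ)
  isLink : ∀ e : E(Γ), Γ.IsLink e (tail e) (head e)

section

variable {α β : Type*} {Γ : Graph α β} {d : ℕ}
  (ω : EdgeOrientation Γ) (q : V(Γ) → EuclideanSpace ℝ (Fin d))

/-- The vector `q_v - q_u` of an edge oriented from `u` to `v`. -/
def edgeVec (e : E(Γ)) : EuclideanSpace ℝ (Fin d) :=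
  q (ω.head e) - q (ω.tail e)

/-- The hyperplane `h_e = {x | d(x, q_u)² - d(x, q_v)² = g(e)}` of the Pythagorean arrangement, for
an edge `e` oriented from `u` to `v`.  A gain function is recorded through its values on the
preferred orientations, i.e. as a point of `E(Γ) → ℝ`. -/
def pythagHyperplane (g : E(Γ) → ℝ) (e : E(Γ)) : Set (EuclideanSpace ℝ (Fin d)) :=
  {x | dist x (q (ω.tail e)) ^ 2 - dist x (q (ω.head e)) ^ 2 = g e}

/-- The intersection of the hyperplanes of the Pythagorean arrangement labeled by `S`. -/
def pythagInter (g : E(Γ) → ℝ) (S : Set E(Γ)) : Set (EuclideanSpace ℝ (Fin d)) :=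
  ⋂ e ∈ S, pythagHyperplane ω q g e

/-- A set of edges is central when the corresponding hyperplanes have a common point. -/
def IsCentral (g : E(Γ) → ℝ) (S : Set E(Γ)) : Prop :=
  (pythagInter ω q g S).Nonempty

/-- `σ` is the semimatroid of the Pythagorean arrangement with gain function `g`: its central sets
are the central sets of edges, and the rank of a central set is the codimension of the corresponding
intersection. -/
def IsPythagSemimatroid (g : E(Γ) → ℝ) (σ : Semimatroid E(Γ)) : Prop :=
  σ.central = {S | IsCentral ω q g S} ∧
    ∀ S : σ.central, σ.rk S + Module.finrank ℝ (vectorSpan ℝ (pythagInter ω q g (S : Set E(Γ)))) = d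

/-- The semimatroids realizable as a Pythagorean arrangement for some gain function, ordered as
labeled semimatroids. -/
def RealizableSemimatroid : Type _ :=
  {σ : Semimatroid E(Γ) // ∃ g, IsPythagSemimatroid ω q g σ}

instance : PartialOrder (RealizableSemimatroid ω q) :=
  inferInstanceAs (PartialOrder {σ : Semimatroid E(Γ) // ∃ g, IsPythagSemimatroid ω q g σ})

/-- The square system matrix of the edges `s 0, …, s r`, at the gains `γ`.  The row of an edge
oriented from `u` to `v` consists of the coordinates of `q_v - q_u`, followed by
`-(γ_e + |q_v|² - |q_u|²) / 2`. -/
def systemMatrix {r : ℕ} (u : Fin r → EuclideanSpace ℝ (Fin d)) (s : Fin (r + 1) → E(Γ))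
    (γ : E(Γ) → ℝ) : Matrix (Fin (r + 1)) (Fin (r + 1)) ℝ :=
  Matrix.of fun i => Fin.snoc (α := fun _ => ℝ)
    (fun j : Fin r => inner ℝ (u j) (edgeVec ω q (s i)))
    (-(1 / 2) * (γ (s i) + ‖q (ω.head (s i))‖ ^ 2 - ‖q (ω.tail (s i))‖ ^ 2))

variable {ω q} in
lemma det_systemMatrix_eq_zero_iff {r : ℕ} {u : Fin r → EuclideanSpace ℝ (Fin d)}
    (hu : Submodule.span ℝ (range u) = Submodule.span ℝ (range (edgeVec ω q)))
    (s : Fin (r + 1) → E(Γ)) (g : E(Γ) → ℝ) :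
    (systemMatrix ω q u s g).det = 0 ↔
      ∃ w : Fin (r + 1) → ℝ, w ≠ 0 ∧ ∑ i, w i • edgeVec ω q (s i) = 0 ∧
        ∑ i, w i * (g (s i) + ‖q (ω.head (s i))‖ ^ 2 - ‖q (ω.tail (s i))‖ ^ 2) = 0 := by
  rw [← Matrix.exists_vecMul_eq_zero_iff]
  refine exists_congr fun w => and_congr_right fun _ => ?_
  rw [sum_smul_eq_zero_iff_inner hu, funext_iff, Fin.forall_fin_succ']
  refine and_congr (forall_congr' fun j => ?_) ?_
  · simp [Matrix.vecMul, dotProduct, systemMatrix, inner_sum, inner_smul_right]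
  · simp only [Matrix.vecMul, dotProduct, systemMatrix, Matrix.of_apply, Fin.snoc_last,
      Pi.zero_apply]
    have h2 : ∀ a : Fin (r + 1) → ℝ,
        (∑ i, w i * (-(1 / 2) * a i) = 0 ↔ ∑ i, w i * a i = 0) := by
      intro a
      have : ∑ i, w i * (-(1 / 2) * a i) = -(1 / 2) * ∑ i, w i * a i := by
        rw [Finset.mul_sum]
        exact Finset.sum_congr rfl fun i _ => by ring
      rw [this]
      simp
    exact h2 fun i => g (s i) + ‖q (ω.head (s i))‖ ^ 2 - ‖q (ω.tail (s i))‖ ^ 2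

variable [Finite E(Γ)]

/-- The matroid at infinity `M_Γ(Q)`, labeled by the edges of `Γ`. -/
def matroidAtInfinity : Matroid E(Γ) :=
  vectorMatroid (edgeVec ω q)


/-- A choice of auxiliary data for a circuit `X` of the matroid at infinity: orthonormal coordinates
`u` on the span of the edge vectors (the standard coordinates of `ℝ^d` are allowed when this span is
everything), and an enumeration `s` of `B ∪ {x}`, where `B` is a basis of the matroid, `x ∉ B` comes
last, and `X` is the fundamental circuit of `x` with respect to `B`. -/
structure CircuitFrame (X : Set E(Γ)) where
  r : ℕ
  u : Fin r → EuclideanSpace ℝ (Fin d)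
  orthonormal : Orthonormal ℝ u
  span_eq : Submodule.span ℝ (range u) = Submodule.span ℝ (range (edgeVec ω q))
  s : Fin (r + 1) → E(Γ)
  injective : Function.Injective s
  isBase : (matroidAtInfinity ω q).IsBase (range fun i : Fin r => s i.castSucc)
  fundCircuit_eq : (matroidAtInfinity ω q).fundCircuit (s (Fin.last r))
    (range fun i : Fin r => s i.castSucc) = X

/-- The hyperplane of nongenericity `F_X` in edge space: the zero set of the determinant of the
system matrix of `B ∪ {x}`, where `X` is the fundamental circuit of `x` with respect to the basis
`B`.  By `mem_nongenericity_iff` and `exists_circuitFrame` below, a choice of the data exists for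
every circuit, and `F_X` does not depend on it. -/
def nongenericity (X : Set E(Γ)) : Set (E(Γ) → ℝ) :=
  {g | ∃ φ : CircuitFrame ω q X, (systemMatrix ω q φ.u φ.s g).det = 0}

/-- The arrangement of all hyperplanes of nongenericity, labeled by the circuits of the matroid at
infinity. -/
def nongenericityArrangement (X : {X : Set E(Γ) // (matroidAtInfinity ω q).IsCircuit X}) :
    Set (E(Γ) → ℝ) :=
  nongenericity ω q X.1

/-- `C(A)`: the circuits `X` with `F_X ⊇ A`. -/
def circuitsOf (A : Set (E(Γ) → ℝ)) : Set (Set E(Γ)) :=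
  {X | (matroidAtInfinity ω q).IsCircuit X ∧ A ⊆ nongenericity ω q X}

/-- `A_g`: the intersection of all `F_X` that contain `g`. -/
def flatOf (g : E(Γ) → ℝ) : Set (E(Γ) → ℝ) :=
  ⋂ X ∈ {X | (matroidAtInfinity ω q).IsCircuit X ∧ g ∈ nongenericity ω q X}, nongenericity ω q X

/-! Well-definedness of the hyperplanes of nongenericity. -/

variable {ω q}

/-- Membership in `F_X` can be tested with any choice of a basis `B`, an element `x` and
coordinates. -/
theorem mem_nongenericity_iff {X : Set E(Γ)} (φ : CircuitFrame ω q X) (g : E(Γ) → ℝ) :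
    g ∈ nongenericity ω q X ↔ (systemMatrix ω q φ.u φ.s g).det = 0 := by
  have main : ∀ φ : CircuitFrame ω q X, (systemMatrix ω q φ.u φ.s g).det = 0 ↔
      ∀ c : E(Γ) → ℝ, (∀ e ∉ X, c e = 0) → ∑ᶠ e, c e • edgeVec ω q e = 0 →
        ∑ᶠ e, c e * (g e + ‖q (ω.head e)‖ ^ 2 - ‖q (ω.tail e)‖ ^ 2) = 0 := by
    intro φ
    have hlast : φ.s (Fin.last φ.r) ∉ range fun i : Fin φ.r => φ.s i.castSucc := by
      rintro ⟨i, hi⟩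
      exact absurd (φ.injective hi) (Fin.castSucc_lt_last i).ne
    have hX : (matroidAtInfinity ω q).IsCircuit X := by
      rw [← φ.fundCircuit_eq]
      exact φ.isBase.fundCircuit_isCircuit (mem_univ _) hlast
    have hXs : X ⊆ range φ.s := by
      refine φ.fundCircuit_eq.symm.subset.trans
        ((Matroid.fundCircuit_subset_insert _ _ _).trans (insert_subset ⟨_, rfl⟩ ?_))
      rintro _ ⟨i, rfl⟩
      exact ⟨_, rfl⟩
    rw [det_systemMatrix_eq_zero_iff φ.span_eq]
    exact exists_relation_iff φ.injective φ.isBase.indep hXs hX.not_indep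
      fun e => g e + ‖q (ω.head e)‖ ^ 2 - ‖q (ω.tail e)‖ ^ 2
  constructor
  · rintro ⟨ψ, hψ⟩
    exact (main φ).2 ((main ψ).1 hψ)
  · exact fun h => ⟨φ, h⟩

/-- Every circuit admits a choice of a basis, an element and coordinates. -/
theorem exists_circuitFrame {X : Set E(Γ)} (hX : (matroidAtInfinity ω q).IsCircuit X) :
    Nonempty (CircuitFrame ω q X) := by
  obtain ⟨x, hx⟩ := hX.nonempty
  obtain ⟨B, hB, hXB⟩ := (hX.sdiff_singleton_indep hx).exists_isBase_superset
  have hXi : X ⊆ insert x B := fun e he => by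
    by_cases h : e = x
    · exact Or.inl h
    · exact Or.inr (hXB ⟨he, h⟩)
  have hxB : x ∉ B := fun h => hX.not_indep
    (hB.indep.subset (hXi.trans (insert_subset h Subset.rfl)))
  obtain ⟨r, b, hb, rfl, hr⟩ := exists_enum_of_isBase hB
  obtain ⟨u, hu, hus⟩ := exists_orthonormal_of_finrank hr
  refine ⟨⟨r, u, hu, hus, Fin.snoc (α := fun _ => E(Γ)) b x, ?_, ?_, ?_⟩⟩
  · exact Fin.snoc_injective_iff.2 ⟨hb, hxB⟩
  · simpa using hB
  · simpa using (hX.eq_fundCircuit_of_subset hB.indep hXi).symm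

end

end Pythagorean

end

noncomputable section

namespace Pythagorean

/-! Expanding the squares turns `h_e` into the linear equation `2⟪q_e, x⟫ = g(e) + |q_v|² - |q_u|²`.
The vectors `q_e` are fixed and only the right-hand side depends on `g`, so centrality is
solvability of a linear system with varying right-hand side.

On a circuit `X` the vectors satisfy one linear relation up to scaling, and the system is solvable
exactly when the right-hand sides satisfy it too. This is the vanishing of the determinant, so `F_X`
consists of the gains for which `X` is central (`mem_nongenericity_iff_isCentral`). Part 2 follows
at once. For part 1, a solution on a basis that meets every member of a modular family in a basis of
that member solves all the central members simultaneously (`solutionSet_sUnion_nonempty`).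

For part 3, a set is central if and only if its circuits are (`solutionSet_nonempty_iff_circuit`),
and ranks do not depend on the gains. Comparing semimatroids therefore means comparing central
circuits, that is, the flats `A_g` (`flatOf_subset_flatOf_iff`). Every flat is some `A_g`: all `F_X`
are translates of linear subspaces by one common vector, and a real vector space is not a finite
union of proper subspaces (`exists_flatOf_eq`). -/

/-! ### Systems of linear equations prescribing inner products -/

section Solutions

variable {ι W : Type*} [NormedAddCommGroup W] [InnerProductSpace ℝ W]

/-- The common solutions `x` of the equations `2 ⟪v e, x⟫ = k e`, for `e ∈ S`. -/
def solutionSet (v : ι → W) (k : ι → ℝ) (S : Set ι) : Set W :=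
  {x | ∀ e ∈ S, 2 * inner ℝ (v e) x = k e}

variable {v : ι → W} {k : ι → ℝ} {S T : Set ι}

lemma solutionSet_anti (h : S ⊆ T) : solutionSet v k T ⊆ solutionSet v k S :=
  fun _ hx e he => hx e (h he)

lemma add_mem_solutionSet_iff {x z : W} (hx : x ∈ solutionSet v k S) :
    x + z ∈ solutionSet v k S ↔ z ∈ (Submodule.span ℝ (v '' S))ᗮ := by
  have h : z ∈ (Submodule.span ℝ (v '' S))ᗮ ↔ ∀ e ∈ S, inner ℝ (v e) z = 0 := by
    constructor
    · exact fun hz e he => hz _ (Submodule.subset_span (mem_image_of_mem v he))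
    · intro hz
      have hle : Submodule.span ℝ (v '' S) ≤ (Submodule.span ℝ {z})ᗮ := by
        rw [Submodule.span_le]
        rintro _ ⟨e, he, rfl⟩
        exact Submodule.mem_orthogonal_singleton_iff_inner_left.2 (hz e he)
      exact fun w hw => Submodule.mem_orthogonal_singleton_iff_inner_left.1 (hle hw)
  rw [h]
  refine forall₂_congr fun e he => ?_
  rw [inner_add_right, mul_add, hx e he]
  simp

/-- A solution of the equations in `T` solves those in `S` when the vectors of `T ⊆ S` span those of
`S` and the system `S` is solvable. -/
lemma mem_solutionSet_of_span {x : W} (hTS : T ⊆ S)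
    (hspan : v '' S ⊆ Submodule.span ℝ (v '' T)) (hx : x ∈ solutionSet v k T)
    (hS : (solutionSet v k S).Nonempty) : x ∈ solutionSet v k S := by
  obtain ⟨y, hy⟩ := hS
  -- Both `x` and `y` solve the equations in `T`, so `x - y` is orthogonal to the span of `T`, hence
  -- to that of `S`; adding it to `y` preserves the equations in `S`.
  have h : x - y ∈ (Submodule.span ℝ (v '' T))ᗮ := by
    rw [← add_mem_solutionSet_iff (solutionSet_anti hTS hy)]
    simpa using hx
  have h' := (add_mem_solutionSet_iff hy).2
    (Submodule.orthogonal_le (Submodule.span_le.2 hspan) h)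
  simpa using h'

lemma vectorSpan_solutionSet (hS : (solutionSet v k S).Nonempty) :
    vectorSpan ℝ (solutionSet v k S) = (Submodule.span ℝ (v '' S))ᗮ := by
  obtain ⟨x, hx⟩ := hS
  have h : solutionSet v k S = AffineSubspace.mk' x (Submodule.span ℝ (v '' S))ᗮ := by
    ext y
    have := add_mem_solutionSet_iff (z := y - x) hx
    rw [SetLike.mem_coe, AffineSubspace.mem_mk', vsub_eq_sub, ← this]
    simp
  rw [h, ← AffineSubspace.direction_eq_vectorSpan, AffineSubspace.direction_mk']

/-- The right-hand sides for which the subsystem `S` is solvable. -/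
def solvableSubmodule (v : ι → W) (S : Set ι) : Submodule ℝ (ι → ℝ) where
  carrier := {k | (solutionSet v k S).Nonempty}
  zero_mem' := ⟨0, fun e _ => by simp⟩
  add_mem' := by
    rintro a b ⟨x, hx⟩ ⟨y, hy⟩
    exact ⟨x + y, fun e he => by simp [inner_add_right, mul_add, hx e he, hy e he]⟩
  smul_mem' := by
    rintro c a ⟨x, hx⟩
    exact ⟨c • x, fun e he => by simp [inner_smul_right, ← hx e he]; ring⟩

variable [FiniteDimensional ℝ W]

/-- Values of a linear functional can be prescribed on independent vectors; after extension to `W`,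
Riesz representation turns the functional into a point. The values `k e / 2` absorb the factor 2 in
the equations. -/
lemma solutionSet_nonempty_of_linearIndepOn (hS : LinearIndepOn ℝ v S) (k : ι → ℝ) :
    (solutionSet v k S).Nonempty := by
  have hli : LinearIndependent ℝ fun e : S => v e := hS
  obtain ⟨f, hf⟩ := LinearMap.exists_extend
    ((Module.Basis.span hli).constr ℝ fun e : S => k e / 2)
  refine ⟨(InnerProductSpace.toDual ℝ W).symm (LinearMap.toContinuousLinearMap f), fun e he => ?_⟩
  have hfe : f (v e) = k e / 2 := by
    have h := LinearMap.congr_fun hf (Module.Basis.span hli ⟨e, he⟩)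
    rwa [Module.Basis.constr_basis, LinearMap.comp_apply, Submodule.subtype_apply,
      Module.Basis.span_apply] at h
  rw [real_inner_comm, InnerProductSpace.toDual_symm_apply, LinearMap.coe_toContinuousLinearMap',
    hfe]
  ring

/-- Some direction `z` is orthogonal to all old vectors but not to `v e`; moving a solution along
`z` adjusts the new equation alone. -/
lemma solutionSet_insert_nonempty {e : ι} (hS : (solutionSet v k S).Nonempty)
    (he : v e ∉ Submodule.span ℝ (v '' S)) : (solutionSet v k (insert e S)).Nonempty := by
  obtain ⟨x, hx⟩ := hS
  rw [← Submodule.orthogonal_orthogonal (Submodule.span ℝ (v '' S)), Submodule.mem_orthogonal] at he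
  push Not at he
  obtain ⟨z, hz, hze⟩ := he
  rw [real_inner_comm] at hze
  obtain ⟨t, ht⟩ : ∃ t, 2 * inner ℝ (v e) x + t * (2 * inner ℝ (v e) z) = k e :=
    ⟨(k e - 2 * inner ℝ (v e) x) / (2 * inner ℝ (v e) z), by field_simp; ring⟩
  refine ⟨x + t • z, ?_⟩
  rintro a (rfl | ha)
  · rw [inner_add_right, inner_smul_right, ← ht]
    ring
  · exact (add_mem_solutionSet_iff hx).2 (Submodule.smul_mem _ _ hz) a ha

end Solutions

/-! ### Solvability in the vectorial matroid -/

section Matroid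

variable {ι W : Type*} [Finite ι] [NormedAddCommGroup W] [InnerProductSpace ℝ W]
  {v : ι → W} {k : ι → ℝ}

lemma image_subset_span_of_isBasis {I S : Set ι} (h : (vectorMatroid v).IsBasis I S) :
    v '' S ⊆ Submodule.span ℝ (v '' I) := by
  rintro _ ⟨e, he, rfl⟩
  by_cases heI : e ∈ I
  · exact Submodule.subset_span ⟨e, heI, rfl⟩
  · by_contra hns
    have hI : LinearIndepOn ℝ v I := h.indep
    exact (h.insert_dep ⟨he, heI⟩).not_indep (hI.insert hns)

variable [FiniteDimensional ℝ W]

/-- Solvability propagates along modular families. -/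
lemma solutionSet_sUnion_nonempty {T : Set (Set ι)} (hT : IsModularFamily (vectorMatroid v) T)
    (h : ∀ X ∈ T, (solutionSet v k X).Nonempty) : (solutionSet v k (⋃₀ T)).Nonempty := by
  obtain ⟨B, hB, hTB⟩ := hT
  -- The point `x` is chosen from `B` alone, so the same `x` serves every member of the family.
  obtain ⟨x, hx⟩ := solutionSet_nonempty_of_linearIndepOn (v := v) hB.indep k
  refine ⟨x, ?_⟩
  rintro e ⟨X, hXT, heX⟩
  exact mem_solutionSet_of_span inter_subset_left (image_subset_span_of_isBasis (hTB X hXT))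
    (solutionSet_anti inter_subset_right hx) (h X hXT) e heX

/-- A system is solvable if and only if it is solvable on circuits. -/
lemma solutionSet_nonempty_iff_circuit {S : Set ι} :
    (solutionSet v k S).Nonempty ↔
      ∀ X ⊆ S, (vectorMatroid v).IsCircuit X → (solutionSet v k X).Nonempty := by
  refine ⟨fun h X hX _ => h.mono (solutionSet_anti hX), fun h => ?_⟩
  obtain ⟨I, hI⟩ := (vectorMatroid v).exists_isBasis S (subset_univ _)
  obtain ⟨x, hx⟩ := solutionSet_nonempty_of_linearIndepOn (v := v) hI.indep k
  refine ⟨x, fun e he => ?_⟩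
  by_cases heI : e ∈ I
  · exact hx e heI
  -- The circuit `X` closed by `e` over `I` is solvable, and `X \ {e}` spans it; since `x` solves `X
  -- \ {e}`, it also solves the equation of `e`.
  obtain ⟨X, hXI, hX⟩ := (hI.insert_dep ⟨he, heI⟩).exists_isCircuit_subset
  have heX : e ∈ X := by
    by_contra hn
    exact hX.not_indep (hI.indep.subset fun a ha => (hXI ha).resolve_left fun h' => hn (h' ▸ ha))
  have hXS : X ⊆ S := hXI.trans (insert_subset he hI.subset)
  have hXeI : X \ {e} ⊆ I := fun a ha => (hXI ha.1).resolve_left ha.2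
  exact mem_solutionSet_of_span sdiff_subset
    (image_subset_span_of_isBasis (hX.sdiff_singleton_isBasis heX))
    (solutionSet_anti hXeI hx) (h X hXS hX) e heX

/-- A system on a dependent set `X` of indices, included in an independent set enlarged by one more
index, is solvable if and only if its right-hand side satisfies a linear relation between the
vectors. -/
lemma exists_relation_iff_solutionSet_nonempty {r : ℕ} {s : Fin (r + 1) → ι}
    (hs : Function.Injective s) (hB : LinearIndepOn ℝ v (range fun i : Fin r => s i.castSucc))
    {X : Set ι} (hXs : X ⊆ range s) (hX : ¬ LinearIndepOn ℝ v X) :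
    (∃ w : Fin (r + 1) → ℝ, w ≠ 0 ∧ ∑ i, w i • v (s i) = 0 ∧ ∑ i, w i * k (s i) = 0) ↔
      (solutionSet v k X).Nonempty := by
  constructor
  · rintro ⟨w, hw0, hw, hwk⟩
    obtain ⟨y, hy⟩ := solutionSet_nonempty_of_linearIndepOn hB k
    have hys : ∀ j : Fin r, 2 * inner ℝ (v (s j.castSucc)) y = k (s j.castSucc) :=
      fun j => hy _ ⟨j, rfl⟩
    -- Otherwise `w` would be a nontrivial relation among the independent first `r` vectors.
    have hwl : w (Fin.last _) ≠ 0 := by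
      intro hl
      rw [Fin.sum_univ_castSucc, hl, zero_smul, add_zero] at hw
      have hli : LinearIndependent ℝ fun i : Fin r => v (s i.castSucc) :=
        (linearIndepOn_range_iff (hs.comp (Fin.castSucc_injective _)) _).1 hB
      have := Fintype.linearIndependent_iff.1 hli _ hw
      exact hw0 (funext fun i => Fin.lastCases hl this i)
    have h0 : ∑ i, w i * inner ℝ (v (s i)) y = 0 := by
      simpa [sum_inner, inner_smul_left] using congrArg (fun z => inner ℝ z y) hw
    have hsum : ∑ i, w i * (k (s i) - 2 * inner ℝ (v (s i)) y) = 0 := by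
      simp only [mul_sub, Finset.sum_sub_distrib, hwk, mul_left_comm _ (2 : ℝ), ← Finset.mul_sum,
        h0, mul_zero, sub_zero]
    -- In `hsum` the first `r` residuals vanish by the choice of `y`, and the coefficient of the
    -- last one is nonzero.
    have hlast : 2 * inner ℝ (v (s (Fin.last r))) y = k (s (Fin.last r)) := by
      rw [Fin.sum_univ_castSucc, Finset.sum_eq_zero, zero_add] at hsum
      · exact (sub_eq_zero.1 ((mul_eq_zero.1 hsum).resolve_left hwl)).symm
      · intro j _
        rw [hys, sub_self, mul_zero]
    refine ⟨y, fun e he => ?_⟩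
    obtain ⟨i, rfl⟩ := hXs he
    exact Fin.lastCases (motive := fun i => 2 * inner ℝ (v (s i)) y = k (s i)) hlast hys i
  · rintro ⟨y, hy⟩
    have : Fintype ι := Fintype.ofFinite _
    -- Nothing is known of `y` outside `X`; the criterion only asks about relations supported on
    -- `X`.
    refine (exists_relation_iff hs hB hXs hX k).2 fun c hc hcv => ?_
    rw [finsum_eq_sum_of_fintype] at hcv ⊢
    have h0 : ∑ e, c e * inner ℝ (v e) y = 0 := by
      simpa [sum_inner, inner_smul_left] using congrArg (fun z => inner ℝ z y) hcv
    rw [← mul_zero 2, ← h0, Finset.mul_sum]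
    refine Finset.sum_congr rfl fun e _ => ?_
    by_cases he : e ∈ X
    · rw [← hy e he]
      ring
    · simp [hc e he]

/-- The semimatroid of solvable subsystems; the rank is the dimension spanned by the vectors. -/
def solutionSemimatroid (v : ι → W) (k : ι → ℝ) : Semimatroid ι where
  central := {S | (solutionSet v k S).Nonempty}
  rk S := Module.finrank ℝ (Submodule.span ℝ (v '' S))
  nonempty := ⟨∅, 0, by simp [solutionSet]⟩
  hereditary _ _ hX hYX := hX.mono (solutionSet_anti hYX)
  subcardinal X := by
    have := Fintype.ofFinite (v '' X)
    calc ((Module.finrank ℝ (Submodule.span ℝ (v '' X)) : ℕ) : ℕ∞)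
        ≤ ((v '' X).toFinset.card : ℕ∞) := by exact_mod_cast finrank_span_le_card (v '' X)
      _ = (v '' X).encard := (encard_eq_coe_toFinset_card _).symm
      _ ≤ (X : Set ι).encard := encard_image_le _ _
  isotone _ _ h := Submodule.finrank_mono (Submodule.span_mono (image_mono h))
  submodular X Y I U hI hU := by
    have h := Submodule.finrank_sup_add_finrank_inf_eq (Submodule.span ℝ (v '' (X : Set ι)))
      (Submodule.span ℝ (v '' (Y : Set ι)))
    rw [← h, hI, hU, image_union, Submodule.span_union, add_comm]
    -- The span of a union is the sum of the spans, but the span of an intersection is only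
    -- contained in the intersection of the spans, hence the inequality.
    refine Nat.add_le_add_left (Submodule.finrank_mono ?_) _
    exact le_inf (Submodule.span_mono (image_mono inter_subset_left))
      (Submodule.span_mono (image_mono inter_subset_right))
  union_central X Y I hI h := by
    have hIX : (I : Set ι) ⊆ X := hI ▸ inter_subset_left
    have hIY : (I : Set ι) ⊆ Y := hI ▸ inter_subset_right
    -- Equal ranks make `X ∩ Y` span `X`, so any solution for `Y` automatically solves `X`.
    have hspan := Submodule.eq_of_le_of_finrank_eq (Submodule.span_mono (image_mono hIX)) h
    obtain ⟨x, hx⟩ := Y.2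
    have hxX := mem_solutionSet_of_span hIX (hspan ▸ Submodule.subset_span)
      (solutionSet_anti hIY hx) X.2
    exact ⟨x, fun e he => he.elim (hxX e) (hx e)⟩
  augment X Y h := by
    obtain ⟨y, hy, hyX⟩ : ∃ y ∈ (Y : Set ι), v y ∉ Submodule.span ℝ (v '' (X : Set ι)) := by
      by_contra! hcon
      refine h.not_ge (Submodule.finrank_mono (Submodule.span_le.2 ?_))
      rintro _ ⟨y, hy, rfl⟩
      exact hcon y hy
    exact ⟨y, ⟨hy, fun h' => hyX (Submodule.subset_span (mem_image_of_mem v h'))⟩,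
      solutionSet_insert_nonempty X.2 hyX⟩

/-- Ranks depend on `v` alone, so only centrality has to be compared, and circuits detect it. -/
lemma solutionSemimatroid_le_iff {k' : ι → ℝ} :
    solutionSemimatroid v k ≤ solutionSemimatroid v k' ↔
      ∀ X, (vectorMatroid v).IsCircuit X → (solutionSet v k X).Nonempty →
        (solutionSet v k' X).Nonempty := by
  constructor
  · exact fun h X _ hX => (h ⟨X, hX⟩).1
  · refine fun h S => ⟨?_, rfl⟩
    exact solutionSet_nonempty_iff_circuit.2 fun X hXS hX =>
      h X hX (solutionSet_nonempty_iff_circuit.1 S.2 X hXS hX)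

end Matroid

/-- Generic point of `P`: those `N i` that do not contain `P` cut out finitely many proper subspaces
of `P`, which cannot cover it over an infinite division ring. -/
lemma exists_mem_forall_mem_imp_le {K E κ : Type*} [DivisionRing K] [Infinite K] [AddCommGroup E]
    [Module K E] [Finite κ] (P : Submodule K E) (N : κ → Submodule K E) :
    ∃ x ∈ P, ∀ i, x ∈ N i → P ≤ N i := by
  classical
  have : Fintype κ := Fintype.ofFinite _
  let s : Finset (Submodule K P) :=
    {i | ¬ P ≤ N i}.toFinset.image fun i => (N i).comap P.subtype
  have hs : ⊤ ∉ s := by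
    simp only [s, Finset.mem_image, mem_toFinset, mem_ofPred_eq, not_exists, not_and]
    exact fun i hi h => hi (Submodule.comap_subtype_eq_top.1 h)
  obtain ⟨x, hx⟩ := (ne_univ_iff_exists_notMem _).1 (Subspace.biUnion_ne_univ_of_top_notMem hs)
  refine ⟨x, x.2, fun i hxi => by_contra fun hi => hx ?_⟩
  simp only [s, mem_iUnion]
  exact ⟨_, Finset.mem_image_of_mem _ (by simpa using hi), hxi⟩

/-! ### Pythagorean arrangements and hyperplanes of nongenericity -/

section

variable {α β : Type*} {Γ : Graph α β} {d : ℕ}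
  (ω : EdgeOrientation Γ) (q : V(Γ) → EuclideanSpace ℝ (Fin d))

/-- The difference `|q_v|² - |q_u|²` for an edge oriented from `u` to `v`; its negative is the gain
function whose hyperplanes all pass through the origin. -/
def normGain (e : E(Γ)) : ℝ :=
  ‖q (ω.head e)‖ ^ 2 - ‖q (ω.tail e)‖ ^ 2

variable {ω q}

lemma pythagInter_eq_solutionSet (g : E(Γ) → ℝ) (S : Set E(Γ)) :
    pythagInter ω q g S = solutionSet (edgeVec ω q) (g + normGain ω q) S := by
  ext x
  simp only [pythagInter, pythagHyperplane, solutionSet, mem_iInter, mem_ofPred_eq, Pi.add_apply]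
  refine forall₂_congr fun e _ => ?_
  rw [dist_eq_norm, dist_eq_norm, norm_sub_sq_real, norm_sub_sq_real, edgeVec, inner_sub_left,
    real_inner_comm x, real_inner_comm x, normGain]
  constructor <;> intro h <;> linarith

lemma isCentral_iff (g : E(Γ) → ℝ) (S : Set E(Γ)) :
    IsCentral ω q g S ↔ (solutionSet (edgeVec ω q) (g + normGain ω q) S).Nonempty := by
  rw [IsCentral, pythagInter_eq_solutionSet]

/-- The equation `rk + dim = d` determines the rank. Uniqueness is what makes every realizable
semimatroid a value of the isomorphism. -/
lemma IsPythagSemimatroid.eq {g : E(Γ) → ℝ} {σ τ : Semimatroid E(Γ)}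
    (hσ : IsPythagSemimatroid ω q g σ) (hτ : IsPythagSemimatroid ω q g τ) : σ = τ := by
  have hle : ∀ {σ τ : Semimatroid E(Γ)}, IsPythagSemimatroid ω q g σ →
      IsPythagSemimatroid ω q g τ → σ ≤ τ := by
    intro σ τ hσ hτ S
    have hS : (S : Set E(Γ)) ∈ τ.central := by rw [hτ.1, ← hσ.1]; exact S.2
    have h1 := hσ.2 S
    have h2 := hτ.2 ⟨S, hS⟩
    exact ⟨hS, Nat.add_right_cancel (h2.trans h1.symm)⟩
  exact le_antisymm (hle hσ hτ) (hle hτ hσ)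

variable [Finite E(Γ)]

variable (ω q) in
/-- The semimatroid of the Pythagorean arrangement of a gain function. -/
def pythagSemimatroid (g : E(Γ) → ℝ) : Semimatroid E(Γ) :=
  solutionSemimatroid (edgeVec ω q) (g + normGain ω q)

lemma isPythagSemimatroid_pythagSemimatroid (g : E(Γ) → ℝ) :
    IsPythagSemimatroid ω q g (pythagSemimatroid ω q g) := by
  refine ⟨Set.ext fun S => (isCentral_iff g S).symm, fun S => ?_⟩
  rw [pythagInter_eq_solutionSet, vectorSpan_solutionSet S.2]
  -- The direction of the intersection is the orthogonal complement of the span of the edge vectors,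
  -- so its codimension is their rank.
  exact (Submodule.finrank_add_finrank_orthogonal _).trans finrank_euclideanSpace_fin

/-- A gain function lies on `F_X` if and only if the circuit `X` is central. -/
lemma mem_nongenericity_iff_isCentral {X : Set E(Γ)} (hX : (matroidAtInfinity ω q).IsCircuit X)
    (g : E(Γ) → ℝ) : g ∈ nongenericity ω q X ↔ IsCentral ω q g X := by
  obtain ⟨φ⟩ := exists_circuitFrame hX
  rw [mem_nongenericity_iff φ, det_systemMatrix_eq_zero_iff φ.span_eq, isCentral_iff]
  have hXs : X ⊆ range φ.s := by
    refine φ.fundCircuit_eq.symm.subset.trans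
      ((Matroid.fundCircuit_subset_insert _ _ _).trans (insert_subset ⟨_, rfl⟩ ?_))
    rintro _ ⟨i, rfl⟩
    exact ⟨_, rfl⟩
  simp only [add_sub_assoc]
  exact exists_relation_iff_solutionSet_nonempty (k := g + normGain ω q) φ.injective
    φ.isBase.indep hXs hX.not_indep

lemma mem_flatOf_self (g : E(Γ) → ℝ) : g ∈ flatOf ω q g :=
  mem_iInter₂.2 fun _ hX => hX.2

/-- As `A_g` contains `g` and lies in every `F_X` through `g`, it lies in `F_X` exactly when `g`
does. -/
lemma mem_circuitsOf_flatOf_iff {g : E(Γ) → ℝ} {X : Set E(Γ)} :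
    X ∈ circuitsOf ω q (flatOf ω q g) ↔
      (matroidAtInfinity ω q).IsCircuit X ∧ IsCentral ω q g X := by
  refine and_congr_right fun hX => ?_
  rw [← mem_nongenericity_iff_isCentral hX]
  exact ⟨fun h => h (mem_flatOf_self g), fun h => biInter_subset_of_mem ⟨hX, h⟩⟩

/-- The circuits whose hyperplanes contain a given set form a linear class. -/
lemma isLinearClass_circuitsOf (A : Set (E(Γ) → ℝ)) :
    IsLinearClass (matroidAtInfinity ω q) (circuitsOf ω q A) := by
  refine ⟨fun X hX => hX.1, fun T hTA hT X hX hXT => ⟨hX, fun g hg => ?_⟩⟩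
  rw [mem_nongenericity_iff_isCentral hX, isCentral_iff]
  -- The argument is pointwise in `g ∈ A`, so `A` can be any set: centrality spreads from the
  -- members of `T` to their union and restricts to `X`.
  refine (solutionSet_sUnion_nonempty hT fun Y hY => ?_).mono (solutionSet_anti hXT)
  rw [← isCentral_iff, ← mem_nongenericity_iff_isCentral (hTA hY).1]
  exact (hTA hY).2 hg

/-! ### The lattice of flats -/

lemma neg_normGain_mem_nongenericity {X : Set E(Γ)} (hX : (matroidAtInfinity ω q).IsCircuit X) :
    -normGain ω q ∈ nongenericity ω q X := by
  rw [mem_nongenericity_iff_isCentral hX, isCentral_iff, neg_add_cancel]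
  exact ⟨0, fun e _ => by simp⟩

/-- All `F_X` share the point `-normGain`, where every right-hand side is zero, so no intersection
of them is empty. -/
lemma isFlat_iInter (T : Set {X : Set E(Γ) // (matroidAtInfinity ω q).IsCircuit X}) :
    IsFlat (nongenericityArrangement ω q) (⋂ X ∈ T, nongenericityArrangement ω q X) :=
  ⟨⟨-normGain ω q, mem_iInter₂.2 fun X _ => neg_normGain_mem_nongenericity X.2⟩, T, rfl⟩

/-- Under reverse inclusion the join of two flats is their intersection. -/
lemma exists_isLUB_pair_flat (A B : Flat (nongenericityArrangement ω q)) :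
    ∃ C, IsLUB {A, B} C := by
  obtain ⟨A, hA⟩ := A
  obtain ⟨B, hB⟩ := B
  obtain ⟨-, S, rfl⟩ := id hA
  obtain ⟨-, T, rfl⟩ := id hB
  refine ⟨⟨_, isFlat_iInter (S ∪ T)⟩, ?_, ?_⟩
  · rintro _ (rfl | rfl)
    · exact biInter_subset_biInter_left subset_union_left
    · exact biInter_subset_biInter_left subset_union_right
  · intro D hD
    have h1 : D.carrier ⊆ _ := hD (mem_insert _ _)
    have h2 : D.carrier ⊆ _ := hD (mem_insert_of_mem _ rfl)
    exact (subset_inter h1 h2).trans (biInter_union S T _).symm.subset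

/-- The meet is the smallest flat containing both: the intersection of all `F_X` that contain their
union. -/
lemma exists_isGLB_pair_flat (A B : Flat (nongenericityArrangement ω q)) :
    ∃ C, IsGLB {A, B} C := by
  refine ⟨⟨_, isFlat_iInter {X | A.carrier ∪ B.carrier ⊆ nongenericityArrangement ω q X}⟩, ?_, ?_⟩
  · rintro _ (rfl | rfl)
    · exact subset_iInter₂ fun X hX => subset_union_left.trans hX
    · exact subset_iInter₂ fun X hX => subset_union_right.trans hX
  · intro D hD
    have h1 : A.carrier ⊆ D.carrier := hD (mem_insert _ _)
    have h2 : B.carrier ⊆ D.carrier := hD (mem_insert_of_mem _ rfl)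
    obtain ⟨D, hD, T, rfl⟩ := D
    refine biInter_subset_biInter_left fun X hX => ?_
    exact union_subset (h1.trans (biInter_subset_of_mem hX)) (h2.trans (biInter_subset_of_mem hX))

/-! ### Flats and realizable semimatroids -/

lemma isFlat_flatOf (g : E(Γ) → ℝ) : IsFlat (nongenericityArrangement ω q) (flatOf ω q g) := by
  convert isFlat_iInter (ω := ω) (q := q) {X | g ∈ nongenericityArrangement ω q X}
  ext γ
  simp [flatOf, nongenericityArrangement]

/-- Every flat is the flat of a generic one of its points. -/
lemma exists_flatOf_eq (A : Flat (nongenericityArrangement ω q)) :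
    ∃ g, flatOf ω q g = A.carrier := by
  obtain ⟨A, -, T, rfl⟩ := A
  -- Translation by `normGain` turns every `F_X` into a linear subspace, where genericity applies.
  have hmem : ∀ (X : {X : Set E(Γ) // (matroidAtInfinity ω q).IsCircuit X}) g,
      g ∈ nongenericityArrangement ω q X ↔
        g + normGain ω q ∈ solvableSubmodule (edgeVec ω q) X.1 := fun X g =>
    (mem_nongenericity_iff_isCentral X.2 g).trans (isCentral_iff g X.1)
  obtain ⟨k, hk, hgen⟩ := exists_mem_forall_mem_imp_le
    (⨅ X ∈ T, solvableSubmodule (edgeVec ω q) X.1)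
    fun X : {X : Set E(Γ) // (matroidAtInfinity ω q).IsCircuit X} =>
      solvableSubmodule (edgeVec ω q) X.1
  simp only [Submodule.mem_iInf] at hk
  refine ⟨k - normGain ω q, Subset.antisymm ?_ ?_⟩
  · refine subset_iInter₂ fun X hX => biInter_subset_of_mem ⟨X.2, ?_⟩
    exact (hmem X _).2 (by simpa using hk X hX)
  -- By genericity, an `F_X` through the chosen point contains the whole flat.
  · refine subset_iInter₂ fun X hX γ hγ => ?_
    refine (hmem ⟨X, hX.1⟩ γ).2 (hgen ⟨X, hX.1⟩ ?_ ?_)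
    · simpa using (hmem ⟨X, hX.1⟩ _).1 hX.2
    · simp only [Submodule.mem_iInf]
      exact fun Y hY => (hmem Y γ).1 (mem_iInter₂.1 hγ Y hY)

/-- Both sides say that every circuit central for `g` is central for `h`. -/
lemma flatOf_subset_flatOf_iff {g h : E(Γ) → ℝ} :
    flatOf ω q h ⊆ flatOf ω q g ↔ pythagSemimatroid ω q g ≤ pythagSemimatroid ω q h := by
  rw [pythagSemimatroid, pythagSemimatroid, solutionSemimatroid_le_iff]
  constructor
  · intro hsub X hX hg
    rw [← isCentral_iff] at hg ⊢
    have hXg := (mem_circuitsOf_flatOf_iff.2 ⟨hX, hg⟩).2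
    exact (mem_circuitsOf_flatOf_iff.1 ⟨hX, hsub.trans hXg⟩).2
  · intro hcirc
    refine biInter_subset_biInter_left fun X hX => ⟨hX.1, ?_⟩
    rw [mem_nongenericity_iff_isCentral hX.1, isCentral_iff]
    exact hcirc X hX.1 ((isCentral_iff g X).1 ((mem_nongenericity_iff_isCentral hX.1 g).1 hX.2))

variable (ω q) in
/-- The flats of the arrangement of hyperplanes of nongenericity correspond to the realizable
semimatroids. -/
lemma exists_orderIso_flat_realizableSemimatroid :
    ∃ Φ : Flat (nongenericityArrangement ω q) ≃o RealizableSemimatroid ω q,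
      ∀ (g : E(Γ) → ℝ) (A : Flat (nongenericityArrangement ω q)),
        A.carrier = flatOf ω q g → IsPythagSemimatroid ω q g (Φ A).1 := by
  choose γ hγ using exists_flatOf_eq (ω := ω) (q := q)
  let f : Flat (nongenericityArrangement ω q) ↪o RealizableSemimatroid ω q :=
    OrderEmbedding.ofMapLEIff
      (fun A => ⟨pythagSemimatroid ω q (γ A), γ A, isPythagSemimatroid_pythagSemimatroid _⟩)
      fun A B => by
        change pythagSemimatroid ω q (γ A) ≤ pythagSemimatroid ω q (γ B) ↔ B.carrier ⊆ A.carrier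
        rw [← flatOf_subset_flatOf_iff, hγ, hγ]
  -- The semimatroid does not depend on the generic gain `γ A` chosen: gains with the same flat have
  -- the same semimatroid.
  have hf : ∀ (g : E(Γ) → ℝ) (A : Flat (nongenericityArrangement ω q)),
      A.carrier = flatOf ω q g → (f A).1 = pythagSemimatroid ω q g := by
    intro g A hA
    have h : flatOf ω q (γ A) = flatOf ω q g := (hγ A).trans hA
    exact le_antisymm (flatOf_subset_flatOf_iff.1 h.symm.subset)
      (flatOf_subset_flatOf_iff.1 h.subset)
  refine ⟨RelIso.ofSurjective f ?_, ?_⟩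
  -- A semimatroid realized by `g` is the image of the flat `A_g`.
  · rintro ⟨σ, g, hσ⟩
    exact ⟨⟨_, isFlat_flatOf g⟩, Subtype.ext
      ((hf g _ rfl).trans ((isPythagSemimatroid_pythagSemimatroid g).eq hσ))⟩
  · intro g A hA
    change IsPythagSemimatroid ω q g (f A).1
    rw [hf g A hA]
    exact isPythagSemimatroid_pythagSemimatroid g

end

end Pythagorean

end

theorem mainTheorem1 {α β : Type*} (Γ : Graph α β) [Γ.Loopless] [Finite V(Γ)] [Finite E(Γ)]
    (ω : Pythagorean.EdgeOrientation Γ) (d : ℕ)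
    (q : V(Γ) → EuclideanSpace ℝ (Fin d)) (hq : Function.Injective q) :
    -- (i) the circuits of a flat form a linear class
    (∀ A : Pythagorean.Flat (Pythagorean.nongenericityArrangement ω q),
      Pythagorean.IsLinearClass (Pythagorean.matroidAtInfinity ω q)
        (Pythagorean.circuitsOf ω q A.carrier)) ∧
    -- (ii) the central circuits are the circuits of the flat of the gain function
    (∀ g : E(Γ) → ℝ,
      {X | (Pythagorean.matroidAtInfinity ω q).IsCircuit X ∧ Pythagorean.IsCentral ω q g X} =
        Pythagorean.circuitsOf ω q (Pythagorean.flatOf ω q g)) ∧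
    -- (iii) the flats form a lattice, isomorphic to the poset of realizable semimatroids, through
    -- an isomorphism that sends the flat of a gain function to its semimatroid
    (∀ A B : Pythagorean.Flat (Pythagorean.nongenericityArrangement ω q),
      (∃ C, IsLUB {A, B} C) ∧ ∃ C, IsGLB {A, B} C) ∧
    ∃ Φ : Pythagorean.Flat (Pythagorean.nongenericityArrangement ω q) ≃o
        Pythagorean.RealizableSemimatroid ω q,
      ∀ (g : E(Γ) → ℝ) (A : Pythagorean.Flat (Pythagorean.nongenericityArrangement ω q)),
        A.carrier = Pythagorean.flatOf ω q g →
          Pythagorean.IsPythagSemimatroid ω q g (Φ A).1 := by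
  exact ⟨fun A => Pythagorean.isLinearClass_circuitsOf A.carrier,
    fun _ => Set.ext fun _ => Pythagorean.mem_circuitsOf_flatOf_iff.symm,
    fun A B => ⟨Pythagorean.exists_isLUB_pair_flat A B, Pythagorean.exists_isGLB_pair_flat A B⟩,
    Pythagorean.exists_orderIso_flat_realizableSemimatroid ω q⟩
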